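/- Let $\mathcal N=\{1,\dots,n\}$ be a set of products, $\mathcal S$ a nonempty finite collection of nonempty subsets (assortments) of $\mathcal N$, and $\mathcal I_{\mathcal S}=\{(i,S): S\in\mathcal S,\ i\in S\}$. Let $\Delta_S$ be the probability simplex in $\mathbb R^S$. A marginal distribution model (MDM) consists of $\nu\in\mathbb R^n$ and probability laws $F_1,\dots,F_n$ on $\mathbb R$, each absolutely continuous, with distribution function strictly increasing on its support and with finite first absolute moment. Let $\Theta$ be the set of joint laws of $(\tilde\epsilon_1,\dots,\tilde\epsilon_n)$ with marginals $F_1,\dots,F_n$. A vector $\boldsymbol x_{\mathcal S}=(x_{i,S})_{(i,S)\in\mathcal I_{\mathcal S}}$ is MDM-representable, $\boldsymbol x_{\mathcal S}\in\mathcal P_{\rm MDM}(\mathcal S)$, if there is one such model such that for every $S\in\mathcal S$ there is $\theta^*\in\Theta$ maximizing $\theta\mapsto\mathbb E_\theta[\max_{i\in S}(\nu_i+\tilde\epsilon_i)]$ over $\Theta$ with $x_{i,S}=\mathbb P_{\theta^*}(i=\arg\max_{j\in S}(\nu_j+\tilde\epsilon_j))$ (unique maximizer) for all $i\in S$. Let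 $\boldsymbol p_{\mathcal S}$ be choice data, i.e. $\boldsymbol p_S\in\Delta_S$ for all $S\in\mathcal S$. For each $S\in\mathcal S$ let $\mathrm{loss}_S(\boldsymbol p_S,\cdot):\Delta_S\to[0,\infty]$ be convex, and either finite everywhere on $\Delta_S$ or continuous on $\Delta_S$. The limit of MDM is $$\mathcal L(\boldsymbol p_{\mathcal S})=\inf\Big\{\sum_{S\in\mathcal S}\mathrm{loss}_S(\boldsymbol p_S,\boldsymbol x_S):\boldsymbol x_{\mathcal S}\in\mathcal P_{\rm MDM}(\mathcal S)\Big\}.$$ Then for any $0<\epsilon<1/(2|\mathcal S|)$, $\mathcal L(\boldsymbol p_{\mathcal S})$ equals the optimal value (infimum) of the mixed-integer convex program $$\begin{aligned} \min_{\boldsymbol x,\boldsymbol\lambda,\boldsymbol\delta}\ &\sum_{S\in\mathcal S}\mathrm{loss}_S(\boldsymbol p_S,\boldsymbol x_S)\\ \text{s.t. }& -\delta_{S,T}\le\lambda_S-\lambda_T\le 1-(1+\epsilon)\delta_{S,T}, && \forall (i,S),(i,T)\in\mathcal I_{\mathcal S},\\ & \delta_{S,T}-1\le x_{i,S}-x_{i,T}\le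 1-\delta_{T,S}, && \forall (i,S),(i,T)\in\mathcal I_{\mathcal S},\\ & -(\delta_{S,T}+\delta_{T,S})\le x_{i,S}-x_{i,T}\le \delta_{S,T}+\delta_{T,S}, && \forall (i,S),(i,T)\in\mathcal I_{\mathcal S},\\ & \textstyle\sum_{i\in S}x_{i,S}=1\ \ \forall S\in\mathcal S,\qquad x_{i,S}\ge 0\ \ \forall (i,S)\in\mathcal I_{\mathcal S},\\ & 0\le\lambda_S\le 1\ \ \forall S\in\mathcal S,\qquad \delta_{S,T}\in\{0,1\}\ \ \forall S,T\in\mathcal S. \end{aligned}$$ If moreover every $\mathrm{loss}_S(\boldsymbol p_S,\cdot)$ is continuous on $\Delta_S$, the minimum of the program is attained. -/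

import Mathlib

open MeasureTheory
open scoped ENNReal NNReal

namespace MDM

/-- The assumption on each marginal law: a probability measure on `ℝ` which is absolutely
continuous, whose distribution function is strictly increasing on its support, and which has a
finite first absolute moment. -/
structure IsMarginal (μ : Measure ℝ) : Prop where
  isProbabilityMeasure : IsProbabilityMeasure μ
  absolutelyContinuous : μ ≪ volume
  strictMonoOn_cdf : StrictMonoOn (ProbabilityTheory.cdf μ) μ.support
  integrable : Integrable (fun t : ℝ => t) μ

/-- The joint laws of `(ε₁, …, εₙ)` with marginal laws `F₁, …, Fₙ`. -/
def jointLaws {n : ℕ} (F : Fin n → Measure ℝ) : Set (Measure (Fin n → ℝ)) :=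
  {θ | IsProbabilityMeasure θ ∧ ∀ i, θ.map (fun e => e i) = F i}

/-- The expected utility `E_θ [max_{i ∈ S} (ν i + ε i)]` of a (nonempty) assortment `S`. -/
noncomputable def expectedUtility {n : ℕ} (ν : Fin n → ℝ) (S : Finset (Fin n))
    (θ : Measure (Fin n → ℝ)) : ℝ :=
  ∫ e, (⨆ i : S, (ν i + e i)) ∂θ

/-- `θ` is a joint law with the given marginals that maximizes the expected utility of `S`. -/
def IsExtremal {n : ℕ} (F : Fin n → Measure ℝ) (ν : Fin n → ℝ) (S : Finset (Fin n))
    (θ : Measure (Fin n → ℝ)) : Prop :=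
  θ ∈ jointLaws F ∧ IsMaxOn (expectedUtility ν S) (jointLaws F) θ

/-- The probability under `θ` that `i` is the utility-maximizing product of `S`. -/
noncomputable def choiceProb {n : ℕ} (ν : Fin n → ℝ) (S : Finset (Fin n))
    (θ : Measure (Fin n → ℝ)) (i : Fin n) : ℝ :=
  θ.real {e | ∀ j ∈ S, j ≠ i → ν j + e j < ν i + e i}

/-- Vectors `(x_{i,S} : i ∈ S, S ∈ 𝒮)`; the entry `x_{i,S}` is `x S i`. -/
abbrev ChoiceVec {n : ℕ} (𝒮 : Finset (Finset (Fin n))) : Type :=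
  (S : 𝒮) → S.1 → ℝ

/-- The choice probabilities on the collection `𝒮` which are representable by a marginal
distribution model; one model `(F, ν)` serves all the assortments. -/
def representable {n : ℕ} (𝒮 : Finset (Finset (Fin n))) : Set (ChoiceVec 𝒮) :=
  {x | ∃ (F : Fin n → Measure ℝ) (ν : Fin n → ℝ), (∀ i, IsMarginal (F i)) ∧
    ∀ S : 𝒮, ∃ θ, IsExtremal F ν S.1 θ ∧ ∀ i : S.1, x S i = choiceProb ν S.1 θ i}

/-- The total loss `∑_S loss_S(p_S, x_S)`. -/
noncomputable def totalLoss {n : ℕ} {𝒮 : Finset (Finset (Fin n))}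
    (loss : (S : 𝒮) → (S.1 → ℝ) → (S.1 → ℝ) → ℝ≥0∞) (p x : ChoiceVec 𝒮) : ℝ≥0∞ :=
  ∑ S, loss S (p S) (x S)

/-- The limit of the marginal distribution model: the smallest loss with which representable
choice probabilities fit the data `p`. -/
noncomputable def limit {n : ℕ} {𝒮 : Finset (Finset (Fin n))}
    (loss : (S : 𝒮) → (S.1 → ℝ) → (S.1 → ℝ) → ℝ≥0∞) (p : ChoiceVec 𝒮) : ℝ≥0∞ :=
  sInf (totalLoss loss p '' representable 𝒮)

/-- The constraints of the mixed-integer program in the variables `x`, `lam`, `δ`. -/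
structure IsFeasible {n : ℕ} {𝒮 : Finset (Finset (Fin n))} (ε : ℝ) (x : ChoiceVec 𝒮)
    (lam : 𝒮 → ℝ) (δ : 𝒮 → 𝒮 → ℝ) : Prop where
  order_lower : ∀ (S T : 𝒮) (i : Fin n), i ∈ S.1 → i ∈ T.1 → -δ S T ≤ lam S - lam T
  order_upper : ∀ (S T : 𝒮) (i : Fin n), i ∈ S.1 → i ∈ T.1 →
    lam S - lam T ≤ 1 - (1 + ε) * δ S T
  mono_lower : ∀ (S T : 𝒮) (i : Fin n) (hS : i ∈ S.1) (hT : i ∈ T.1),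
    δ S T - 1 ≤ x S ⟨i, hS⟩ - x T ⟨i, hT⟩
  mono_upper : ∀ (S T : 𝒮) (i : Fin n) (hS : i ∈ S.1) (hT : i ∈ T.1),
    x S ⟨i, hS⟩ - x T ⟨i, hT⟩ ≤ 1 - δ T S
  tie_lower : ∀ (S T : 𝒮) (i : Fin n) (hS : i ∈ S.1) (hT : i ∈ T.1),
    -(δ S T + δ T S) ≤ x S ⟨i, hS⟩ - x T ⟨i, hT⟩
  tie_upper : ∀ (S T : 𝒮) (i : Fin n) (hS : i ∈ S.1) (hT : i ∈ T.1),
    x S ⟨i, hS⟩ - x T ⟨i, hT⟩ ≤ δ S T + δ T S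
  sum_eq_one : ∀ S : 𝒮, ∑ i, x S i = 1
  nonneg : ∀ (S : 𝒮) (i : S.1), 0 ≤ x S i
  lam_nonneg : ∀ S : 𝒮, 0 ≤ lam S
  lam_le_one : ∀ S : 𝒮, lam S ≤ 1
  binary : ∀ S T : 𝒮, δ S T = 0 ∨ δ S T = 1

/-- The objective values attained at feasible points of the mixed-integer program. -/
def feasibleValues {n : ℕ} {𝒮 : Finset (Finset (Fin n))}
    (loss : (S : 𝒮) → (S.1 → ℝ) → (S.1 → ℝ) → ℝ≥0∞) (p : ChoiceVec 𝒮) (ε : ℝ) : Set ℝ≥0∞ :=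
  {v | ∃ (x : ChoiceVec 𝒮) (lam : 𝒮 → ℝ) (δ : 𝒮 → 𝒮 → ℝ),
    IsFeasible ε x lam δ ∧ totalLoss loss p x = v}

end MDM

/-! Lagrangian duality bounds the expected utility of S by l + Σ_{i∈S} E(ν_i + ε_i - l)⁺ for every
l. If the tails P(ε_i > l - ν_i), i ∈ S, sum to one, a coupling under which exactly one of these
events occurs attains the bound, and every extremal law then has these tails as choice probabilities
(`exists_isExtremal`, `IsExtremal.choiceProb_eq`). So a single multiplier l_S governs all products
of S, and x_{i,S} is antitone in l_S for each i. Ranking the multipliers yields λ and δ: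
representable vectors are feasible.

The converse fails, since feasibility tolerates x_{i,S} = x_{i,T} with distinct multipliers. But a
feasible x is an endpoint of a segment whose other points are all representable
(`IsFeasible.exists_segment`): the gap ε leaves room to choose new multipliers and a direction that
sums to zero on each assortment, breaks unwanted ties strictly and lifts zero entries. Strictly
antitone positive data are representable by interpolating tails (`mem_representable_of_strictAnti`).
Along the segment the loss is bounded by a function tending to its value at x, so the two infima
agree. Attainment is compactness of the feasible set. -/

namespace MDM

/-! ### Pointwise bound of a maximum by positive parts -/

section Pointwise

variable {n : ℕ} (S : Finset (Fin n)) (v : Fin n → ℝ) (l : ℝ)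

lemma iSup_le_add_sum_posPart (hS : S.Nonempty) :
    (⨆ i : S, v i) ≤ l + ∑ i ∈ S, max (v i - l) 0 := by
  have : Nonempty S := hS.to_subtype
  refine ciSup_le fun i => ?_
  have h := Finset.single_le_sum (f := fun i => max (v i - l) 0)
    (fun j _ => le_max_right _ _) i.2
  have h' := le_max_left (v i - l) 0
  linarith

variable {S v l}

lemma iSup_eq_add_sum_posPart {i : Fin n} (hi : i ∈ S) (hl : l < v i)
    (hj : ∀ j ∈ S, j ≠ i → v j ≤ l) :
    (⨆ i : S, v i) = l + ∑ i ∈ S, max (v i - l) 0 := by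
  refine le_antisymm (iSup_le_add_sum_posPart S v l ⟨i, hi⟩) ?_
  rw [Finset.sum_eq_single_of_mem i hi fun j hjS hji =>
    max_eq_right (sub_nonpos.2 (hj j hjS hji)), max_eq_left (by linarith)]
  have := le_ciSup (f := fun i : S => v i) (Set.finite_range _).bddAbove ⟨i, hi⟩
  simp only at this
  linarith

/-- Equality leaves room for only one positive part, that of the maximizer; every other value lies
below `l`. -/
lemma isStrictMax_iff_lt_of_iSup_eq (h : (⨆ i : S, v i) = l + ∑ i ∈ S, max (v i - l) 0)
    (hne : ∀ i ∈ S, v i ≠ l) {i : Fin n} (hi : i ∈ S) :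
    (∀ j ∈ S, j ≠ i → v j < v i) ↔ l < v i := by
  have : Nonempty S := ⟨⟨i, hi⟩⟩
  obtain ⟨⟨k, hk⟩, hkv⟩ := exists_eq_ciSup_of_finite (f := fun i : S => v i)
  have hnonneg : ∀ j ∈ S, 0 ≤ max (v j - l) 0 := fun j _ => le_max_right _ _
  have hkl : l < v k := by
    have := Finset.sum_nonneg hnonneg
    exact lt_of_le_of_ne (by simp only at hkv; linarith) (hne k hk).symm
  have hother : ∀ j ∈ S, j ≠ k → v j < l := by
    intro j hj hjk
    have h1 := Finset.add_le_sum hnonneg hk hj hjk.symm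
    have h2 := le_max_left (v k - l) 0
    have h3 := le_max_left (v j - l) 0
    simp only at hkv
    exact lt_of_le_of_ne (by linarith) (hne j hj)
  constructor
  · intro hmax
    by_cases hik : i = k
    · rwa [hik]
    · exact hkl.trans (hmax k hk (Ne.symm hik))
  · intro hli j hj hji
    have hik : i = k := by
      by_contra hik
      exact absurd (hother i hi hik) hli.not_gt
    exact (hother j hj (hik ▸ hji)).trans hli

end Pointwise

/-! ### Weak duality and complementary slackness -/

section Duality

variable {n : ℕ} {F : Fin n → Measure ℝ} {ν : Fin n → ℝ} {S : Finset (Fin n)}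
  {θ : Measure (Fin n → ℝ)}

/-- The value at the multiplier `l` of the dual of the problem of maximizing the expected
utility. -/
noncomputable def dualValue (F : Fin n → Measure ℝ) (ν : Fin n → ℝ) (S : Finset (Fin n))
    (l : ℝ) : ℝ :=
  l + ∑ i ∈ S, ∫ t, max (ν i + t - l) 0 ∂F i

lemma integrable_comp_eval (hF : ∀ i, IsMarginal (F i)) (hθ : θ ∈ jointLaws F) (i : Fin n) :
    Integrable (fun e : Fin n → ℝ => e i) θ := by
  have h := (hF i).integrable
  rw [← hθ.2 i] at h
  exact h.comp_measurable (measurable_pi_apply i)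

lemma integrable_posPart (hF : ∀ i, IsMarginal (F i)) (hθ : θ ∈ jointLaws F) (i : Fin n)
    (l : ℝ) : Integrable (fun e : Fin n → ℝ => max (ν i + e i - l) 0) θ := by
  have := hθ.1
  exact (((integrable_const (ν i)).add (integrable_comp_eval hF hθ i)).sub
    (integrable_const l)).pos_part

lemma integrable_dual (hF : ∀ i, IsMarginal (F i)) (hθ : θ ∈ jointLaws F) (l : ℝ) :
    Integrable (fun e : Fin n → ℝ => l + ∑ i ∈ S, max (ν i + e i - l) 0) θ := by
  have := hθ.1
  exact (integrable_const l).add (integrable_finsetSum S fun i _ => integrable_posPart hF hθ i l)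

lemma integral_dual (hF : ∀ i, IsMarginal (F i)) (hθ : θ ∈ jointLaws F) (l : ℝ) :
    ∫ e, (l + ∑ i ∈ S, max (ν i + e i - l) 0) ∂θ = dualValue F ν S l := by
  have := hθ.1
  rw [integral_add (integrable_const l)
    (integrable_finsetSum S fun i _ => integrable_posPart hF hθ i l),
    integral_finsetSum S fun i _ => integrable_posPart hF hθ i l]
  simp only [integral_const, probReal_univ, one_smul, dualValue]
  congr 1
  refine Finset.sum_congr rfl fun i _ => ?_
  rw [← hθ.2 i, integral_map (measurable_pi_apply i).aemeasurable]
  exact (by fun_prop : Continuous fun t : ℝ => max (ν i + t - l) 0).aestronglyMeasurable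

lemma integrable_utility (hF : ∀ i, IsMarginal (F i)) (hθ : θ ∈ jointLaws F)
    (hS : S.Nonempty) : Integrable (fun e : Fin n → ℝ => ⨆ i : S, (ν i + e i)) θ := by
  have := hθ.1
  have : Nonempty S := hS.to_subtype
  have hint : ∀ i, Integrable (fun e : Fin n → ℝ => ν i + e i) θ := fun i =>
    (integrable_const (ν i)).add (integrable_comp_eval hF hθ i)
  refine Integrable.mono' (integrable_finsetSum S fun i _ => (hint i).abs) ?_ ?_
  · refine Measurable.aestronglyMeasurable (Measurable.iSup fun i => ?_)
    fun_prop
  · refine Filter.Eventually.of_forall fun e => ?_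
    obtain ⟨⟨k, hk⟩, hkv⟩ := exists_eq_ciSup_of_finite (f := fun i : S => ν i + e i)
    rw [← hkv, Real.norm_eq_abs]
    exact Finset.single_le_sum (f := fun i => |ν i + e i|) (fun j _ => abs_nonneg _) hk

lemma expectedUtility_le_dualValue (hF : ∀ i, IsMarginal (F i)) (hθ : θ ∈ jointLaws F)
    (hS : S.Nonempty) (l : ℝ) : expectedUtility ν S θ ≤ dualValue F ν S l := by
  rw [← integral_dual hF hθ l]
  exact integral_mono (integrable_utility hF hθ hS) (integrable_dual hF hθ l)
    fun e => iSup_le_add_sum_posPart S (fun i => ν i + e i) l hS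

lemma IsMarginal.measure_singleton {μ : Measure ℝ} (h : IsMarginal μ) (a : ℝ) : μ {a} = 0 :=
  h.absolutelyContinuous Real.volume_singleton

lemma ae_ne (hF : ∀ i, IsMarginal (F i)) (hθ : θ ∈ jointLaws F) (l : ℝ) :
    ∀ᵐ e ∂θ, ∀ i ∈ S, ν i + e i ≠ l := by
  refine (Filter.eventually_all_finset S).2 fun i _ => ?_
  have h : ∀ᵐ t ∂(θ.map fun e => e i), t ≠ l - ν i := by
    rw [hθ.2 i, ae_iff]
    simpa using (hF i).measure_singleton (l - ν i)
  filter_upwards [ae_of_ae_map (measurable_pi_apply i).aemeasurable h] with e he hl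
  exact he (by linarith)

/-- Complementary slackness: equal integrals force almost sure equality in the pointwise bound. The
marginals have no atoms, so almost surely no utility equals `l`, and being the strict maximizer
means exceeding `l`. -/
lemma choiceProb_eq_of_expectedUtility_eq (hF : ∀ i, IsMarginal (F i)) (hθ : θ ∈ jointLaws F)
    {l : ℝ} (h : expectedUtility ν S θ = dualValue F ν S l) {i : Fin n} (hi : i ∈ S) :
    choiceProb ν S θ i = (F i).real (Set.Ioi (l - ν i)) := by
  have hS : S.Nonempty := ⟨i, hi⟩
  have hle : ∀ e : Fin n → ℝ, (⨆ i : S, (ν i + e i)) ≤ l + ∑ i ∈ S, max (ν i + e i - l) 0 :=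
    fun e => iSup_le_add_sum_posPart S (fun i => ν i + e i) l hS
  have hae := (integral_eq_iff_of_ae_le (integrable_utility hF hθ hS)
    (integrable_dual hF hθ l) (Filter.Eventually.of_forall hle)).1
    (h.trans (integral_dual hF hθ l).symm)
  have hset : {e : Fin n → ℝ | ∀ j ∈ S, j ≠ i → ν j + e j < ν i + e i} =ᵐ[θ]
      (fun e : Fin n → ℝ => e i) ⁻¹' Set.Ioi (l - ν i) := by
    refine Filter.eventuallyEq_set.2 ?_
    filter_upwards [hae, ae_ne hF hθ l] with e he hne
    have := isStrictMax_iff_lt_of_iSup_eq (v := fun i => ν i + e i) he hne hi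
    simp only [Set.mem_preimage, Set.mem_Ioi] at this ⊢
    rw [this]
    constructor <;> intro <;> linarith
  rw [choiceProb, measureReal_congr hset, ← hθ.2 i,
    map_measureReal_apply (measurable_pi_apply i) measurableSet_Ioi]

end Duality

/-! ### A coupling under which exactly one event occurs -/

section Coupling

open ProbabilityTheory

lemma measure_smul_cond {Ω : Type*} [MeasurableSpace Ω] (μ : Measure Ω) [IsFiniteMeasure μ]
    (A : Set Ω) : μ A • cond μ A = μ.restrict A := by
  by_cases h : μ A = 0
  · rw [h, zero_smul, Measure.restrict_eq_zero.2 h]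
  · rw [ProbabilityTheory.cond, smul_smul, ENNReal.mul_inv_cancel h (measure_ne_top μ A), one_smul]

variable {n : ℕ} (F : Fin n → Measure ℝ) (S : Finset (Fin n)) (A : Fin n → Set ℝ)

/-- The marginal laws of the exclusive coupling on the event that `i` is the selected index. -/
noncomputable def exclusiveMarginal (i j : Fin n) : Measure ℝ :=
  if j ∈ S then if j = i then cond (F j) (A j) else cond (F j) (A j)ᶜ else F j

/-- A coupling of the laws `F j` for which exactly one of the events `A i`, `i ∈ S`, occurs,
provided that the probabilities of these events add up to one. -/
noncomputable def exclusiveCoupling : Measure (Fin n → ℝ) :=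
  ∑ i ∈ S, F i (A i) • Measure.pi (exclusiveMarginal F S A i)

variable {F S A} [∀ i, IsProbabilityMeasure (F i)]

lemma measure_compl_ne_zero (hA : ∀ i, MeasurableSet (A i)) (hsum : ∑ i ∈ S, F i (A i) = 1)
    {i j : Fin n} (hi : i ∈ S) (hj : j ∈ S) (hji : j ≠ i) (h0 : F i (A i) ≠ 0) :
    F j (A j)ᶜ ≠ 0 := by
  intro h
  have h1 : F j (A j) = 1 := (prob_compl_eq_zero_iff (hA j)).1 h
  have h2 : F i (A i) + F j (A j) ≤ 1 := hsum ▸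
    Finset.add_le_sum (f := fun i => F i (A i)) (fun _ _ => zero_le) hi hj hji.symm
  rw [h1] at h2
  have h3 : F i (A i) + 1 ≤ 0 + 1 := by simpa using h2
  exact h0 (nonpos_iff_eq_zero.1 ((ENNReal.add_le_add_iff_right ENNReal.one_ne_top).1 h3))

lemma isProbabilityMeasure_exclusiveMarginal (hA : ∀ i, MeasurableSet (A i))
    (hsum : ∑ i ∈ S, F i (A i) = 1) {i : Fin n} (hi : i ∈ S) (h0 : F i (A i) ≠ 0) (j : Fin n) :
    IsProbabilityMeasure (exclusiveMarginal F S A i j) := by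
  unfold exclusiveMarginal
  split_ifs with hj hji
  · subst hji
    exact cond_isProbabilityMeasure h0
  · exact cond_isProbabilityMeasure (measure_compl_ne_zero hA hsum hi hj hji h0)
  · infer_instance

lemma smul_map_pi_exclusiveMarginal (hA : ∀ i, MeasurableSet (A i))
    (hsum : ∑ i ∈ S, F i (A i) = 1) {i : Fin n} (hi : i ∈ S) (j : Fin n) :
    F i (A i) • (Measure.pi (exclusiveMarginal F S A i)).map (fun e => e j) =
      F i (A i) • exclusiveMarginal F S A i j := by
  by_cases h0 : F i (A i) = 0
  · simp [h0]
  · have := isProbabilityMeasure_exclusiveMarginal hA hsum hi h0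
    congr 1
    exact (measurePreserving_eval (exclusiveMarginal F S A i) j).map_eq

/-- Law of total probability: for `j ∈ S` the weights of the indices other than `j` add up to the
mass of `(A j)ᶜ`. -/
lemma sum_smul_exclusiveMarginal (hA : ∀ i, MeasurableSet (A i))
    (hsum : ∑ i ∈ S, F i (A i) = 1) (j : Fin n) :
    ∑ i ∈ S, F i (A i) • exclusiveMarginal F S A i j = F j := by
  by_cases hj : j ∈ S
  · rw [← Finset.add_sum_erase S _ hj]
    have h1 : ∑ i ∈ S.erase j, F i (A i) • exclusiveMarginal F S A i j =
        (∑ i ∈ S.erase j, F i (A i)) • cond (F j) (A j)ᶜ := by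
      rw [Finset.sum_smul]
      refine Finset.sum_congr rfl fun i hi => ?_
      rw [exclusiveMarginal, if_pos hj, if_neg (Finset.ne_of_mem_erase hi).symm]
    have h2 : ∑ i ∈ S.erase j, F i (A i) = F j (A j)ᶜ := by
      rw [prob_compl_eq_one_sub (hA j), ← hsum, ← Finset.add_sum_erase S _ hj]
      exact (ENNReal.add_sub_cancel_left (measure_ne_top _ _)).symm
    rw [h1, h2, exclusiveMarginal, if_pos hj, if_pos rfl, measure_smul_cond, measure_smul_cond,
      Measure.restrict_add_restrict_compl (hA j)]
  · simp only [exclusiveMarginal, if_neg hj]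
    rw [← Finset.sum_smul, hsum, one_smul]

lemma map_exclusiveCoupling (hA : ∀ i, MeasurableSet (A i)) (hsum : ∑ i ∈ S, F i (A i) = 1)
    (j : Fin n) : (exclusiveCoupling F S A).map (fun e => e j) = F j := by
  rw [exclusiveCoupling, Measure.map_finset_sum (measurable_pi_apply j).aemeasurable]
  simp only [Measure.map_smul]
  rw [Finset.sum_congr rfl fun i hi => smul_map_pi_exclusiveMarginal hA hsum hi j]
  exact sum_smul_exclusiveMarginal hA hsum j

lemma isProbabilityMeasure_exclusiveCoupling (hA : ∀ i, MeasurableSet (A i))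
    (hS : S.Nonempty) (hsum : ∑ i ∈ S, F i (A i) = 1) :
    IsProbabilityMeasure (exclusiveCoupling F S A) := by
  obtain ⟨j, -⟩ := hS
  have h := map_exclusiveCoupling hA hsum j
  constructor
  rw [← measure_univ (μ := F j), ← h, Measure.map_apply (measurable_pi_apply j) .univ,
    Set.preimage_univ]

lemma ae_exclusiveCoupling (hA : ∀ i, MeasurableSet (A i)) (hsum : ∑ i ∈ S, F i (A i) = 1) :
    ∀ᵐ e ∂(exclusiveCoupling F S A), ∃ i ∈ S, e i ∈ A i ∧ ∀ j ∈ S, j ≠ i → e j ∉ A j := by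
  rw [exclusiveCoupling, ae_finsetSum_measure_iff]
  intro i hi
  by_cases h0 : F i (A i) = 0
  · simp [h0]
  have := isProbabilityMeasure_exclusiveMarginal hA hsum hi h0
  refine Measure.ae_smul_measure ?_ _
  have hmap := fun j => (measurePreserving_eval (exclusiveMarginal F S A i) j).map_eq
  have hi' : ∀ᵐ e ∂(Measure.pi (exclusiveMarginal F S A i)), e i ∈ A i := by
    refine ae_of_ae_map (f := fun e : Fin n → ℝ => e i) (p := fun t => t ∈ A i)
      (measurable_pi_apply i).aemeasurable ?_
    erw [hmap i]
    rw [exclusiveMarginal, if_pos hi, if_pos rfl]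
    exact ae_cond_mem (hA i)
  have hj' : ∀ᵐ e ∂(Measure.pi (exclusiveMarginal F S A i)), ∀ j ∈ S, j ≠ i → e j ∉ A j := by
    refine (Filter.eventually_all_finset S).2 fun j hj => ?_
    by_cases hji : j = i
    · simp [hji]
    have : ∀ᵐ e ∂(Measure.pi (exclusiveMarginal F S A i)), e j ∈ (A j)ᶜ := by
      refine ae_of_ae_map (f := fun e : Fin n → ℝ => e j) (p := fun t => t ∈ (A j)ᶜ)
        (measurable_pi_apply j).aemeasurable ?_
      erw [hmap j]
      rw [exclusiveMarginal, if_pos hj, if_neg hji]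
      exact ae_cond_mem (hA j).compl
    filter_upwards [this] with e he _ using he
  filter_upwards [hi', hj'] with e h1 h2 using ⟨i, hi, h1, h2⟩

end Coupling

/-! ### Strong duality and extremal choice probabilities -/

section Extremal

variable {n : ℕ} {F : Fin n → Measure ℝ} {ν : Fin n → ℝ} {S : Finset (Fin n)}

/-- Under the exclusive coupling exactly one utility exceeds `l`, which is the equality case of the
pointwise bound. -/
lemma exists_expectedUtility_eq_dualValue (hF : ∀ i, IsMarginal (F i)) (hS : S.Nonempty) {l : ℝ}
    (hl : ∑ i ∈ S, (F i).real (Set.Ioi (l - ν i)) = 1) :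
    ∃ θ ∈ jointLaws F, expectedUtility ν S θ = dualValue F ν S l := by
  have := fun i => (hF i).isProbabilityMeasure
  have hA : ∀ i, MeasurableSet (Set.Ioi (l - ν i)) := fun i => measurableSet_Ioi
  have hsum : ∑ i ∈ S, F i (Set.Ioi (l - ν i)) = 1 := by
    rw [← ENNReal.toReal_eq_one_iff, ENNReal.toReal_sum fun _ _ => measure_ne_top _ _]
    exact hl
  have hθ : exclusiveCoupling F S (fun i => Set.Ioi (l - ν i)) ∈ jointLaws F :=
    ⟨isProbabilityMeasure_exclusiveCoupling hA hS hsum, map_exclusiveCoupling hA hsum⟩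
  refine ⟨_, hθ, ?_⟩
  rw [← integral_dual hF hθ l]
  refine integral_congr_ae ?_
  filter_upwards [ae_exclusiveCoupling hA hsum] with e ⟨i, hi, h1, h2⟩
  refine iSup_eq_add_sum_posPart (v := fun i => ν i + e i) hi ?_ fun j hj hji => ?_
  · rw [Set.mem_Ioi] at h1
    linarith
  · have := h2 j hj hji
    rw [Set.mem_Ioi, not_lt] at this
    linarith

lemma exists_isExtremal (hF : ∀ i, IsMarginal (F i)) (hS : S.Nonempty) {l : ℝ}
    (hl : ∑ i ∈ S, (F i).real (Set.Ioi (l - ν i)) = 1) :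
    ∃ θ, IsExtremal F ν S θ ∧
      ∀ i ∈ S, choiceProb ν S θ i = (F i).real (Set.Ioi (l - ν i)) := by
  obtain ⟨θ, hθ, h⟩ := exists_expectedUtility_eq_dualValue hF hS hl
  refine ⟨θ, ⟨hθ, fun θ' hθ' => ?_⟩, fun i hi =>
    choiceProb_eq_of_expectedUtility_eq hF hθ h hi⟩
  exact (expectedUtility_le_dualValue hF hθ' hS l).trans h.ge

lemma IsExtremal.choiceProb_eq {θ : Measure (Fin n → ℝ)} (hθ : IsExtremal F ν S θ)
    (hF : ∀ i, IsMarginal (F i)) {l : ℝ}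
    (hl : ∑ i ∈ S, (F i).real (Set.Ioi (l - ν i)) = 1) {i : Fin n} (hi : i ∈ S) :
    choiceProb ν S θ i = (F i).real (Set.Ioi (l - ν i)) := by
  obtain ⟨θ', hθ', h⟩ := exists_expectedUtility_eq_dualValue hF ⟨i, hi⟩ hl
  refine choiceProb_eq_of_expectedUtility_eq hF hθ.1 (le_antisymm
    (expectedUtility_le_dualValue hF hθ.1 ⟨i, hi⟩ l) (h.ge.trans (hθ.2 hθ'))) hi

open ProbabilityTheory in
lemma IsMarginal.real_Ioi {μ : Measure ℝ} (h : IsMarginal μ) (a : ℝ) :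
    μ.real (Set.Ioi a) = 1 - cdf μ a := by
  have := h.isProbabilityMeasure
  rw [cdf_eq_real, ← Set.compl_Iic, probReal_compl_eq_one_sub measurableSet_Iic]

open ProbabilityTheory in
lemma IsMarginal.continuous_cdf {μ : Measure ℝ} (h : IsMarginal μ) : Continuous (cdf μ) := by
  have := h.isProbabilityMeasure
  refine continuous_iff_continuousAt.2 fun a => ?_
  refine (cdf μ).mono.continuousAt_iff_leftLim_eq_rightLim.2 ?_
  have h1 := (cdf μ).measure_singleton a
  rw [measure_cdf, h.measure_singleton a] at h1
  rw [StieltjesFunction.rightLim_eq]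
  have h2 := ENNReal.ofReal_eq_zero.1 h1.symm
  exact le_antisymm ((cdf μ).mono.leftLim_le le_rfl) (by linarith)

open ProbabilityTheory Filter Topology in
-- Intermediate values: the continuous sum tends to |S| > 1 at -∞ and to 0 at +∞. For a singleton
-- and a marginal unbounded below, no such `l` exists.
lemma exists_sum_tail_eq_one (hF : ∀ i, IsMarginal (F i)) (hS : 1 < S.card) :
    ∃ l : ℝ, ∑ i ∈ S, (F i).real (Set.Ioi (l - ν i)) = 1 := by
  have hprob := fun i => (hF i).isProbabilityMeasure
  simp only [fun i a => (hF i).real_Ioi a]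
  have hcont : Continuous fun l : ℝ => ∑ i ∈ S, (1 - cdf (F i) (l - ν i)) :=
    continuous_finsetSum S fun i _ =>
      continuous_const.sub ((hF i).continuous_cdf.comp (by fun_prop))
  have hbot : Tendsto (fun l : ℝ => ∑ i ∈ S, (1 - cdf (F i) (l - ν i))) atBot
      (𝓝 (∑ i ∈ S, (1 - 0))) :=
    tendsto_finsetSum S fun i _ => tendsto_const_nhds.sub
      ((tendsto_cdf_atBot (F i)).comp (tendsto_atBot_add_const_right _ _ tendsto_id))
  have htop : Tendsto (fun l : ℝ => ∑ i ∈ S, (1 - cdf (F i) (l - ν i))) atTop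
      (𝓝 (∑ i ∈ S, (1 - 1))) :=
    tendsto_finsetSum S fun i _ => tendsto_const_nhds.sub
      ((tendsto_cdf_atTop (F i)).comp (tendsto_atTop_add_const_right _ _ tendsto_id))
  obtain ⟨a, ha⟩ := (hbot.eventually_const_lt (u := (1 : ℝ)) (by simpa using hS)).exists
  obtain ⟨b, hb⟩ := (htop.eventually_lt_const (u := (1 : ℝ)) (by simp)).exists
  exact mem_range_of_exists_le_of_exists_ge hcont ⟨b, hb.le⟩ ⟨a, ha.le⟩

end Extremal

/-! ### Marginals with prescribed tails -/

section Interpolation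

open ProbabilityTheory in
lemma isMarginal_withDensity {ρ : ℝ → ℝ≥0∞} {a b : ℝ}
    (hpos : ∀ t ∈ Set.Ioc a b, ρ t ≠ 0) (hzero : ∀ t ∉ Set.Ioc a b, ρ t = 0)
    (hρ : Measurable ρ) (hone : ∫⁻ t, ρ t = 1) : IsMarginal (volume.withDensity ρ) := by
  have hprob : IsProbabilityMeasure (volume.withDensity ρ) :=
    ⟨by rw [withDensity_apply _ .univ, Measure.restrict_univ, hone]⟩
  have hae : ∀ᵐ t ∂(volume.withDensity ρ), t ∈ Set.Icc a b := by
    rw [ae_iff, withDensity_apply_eq_zero hρ]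
    refine measure_mono_null (fun t ht => ?_) (measure_empty (μ := volume))
    exact ht.2 (Set.Ioc_subset_Icc_self (by_contra fun h => ht.1 (hzero t h)))
  refine ⟨hprob, withDensity_absolutelyContinuous _ _, ?_,
    Integrable.of_mem_Icc a b aemeasurable_id hae⟩
  have hsupp : (volume.withDensity ρ).support ⊆ Set.Icc a b :=
    Measure.support_subset_of_isClosed isClosed_Icc hae
  intro x hx y hy hxy
  have hx := hsupp hx
  have hy := hsupp hy
  have hne : volume.withDensity ρ (Set.Ioc x y) ≠ 0 := by
    rw [Ne, withDensity_apply_eq_zero hρ]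
    have : {t | ρ t ≠ 0} ∩ Set.Ioc x y = Set.Ioc x y :=
      Set.inter_eq_right.2 fun t ht => hpos t ⟨hx.1.trans_lt ht.1, ht.2.trans hy.2⟩
    rw [this, Real.volume_Ioc]
    simpa using hxy
  rw [← measure_cdf (volume.withDensity ρ), StieltjesFunction.measure_Ioc, Ne,
    ENNReal.ofReal_eq_zero, not_le, sub_pos] at hne
  exact hne

/-- A step density built from right to left. Positivity on the whole of one interval is what later
makes the distribution function strictly increasing on the support. -/
lemma exists_density_tail_eq (P : Finset ℝ) (hP : P.Nonempty) (z : ℝ → ℝ)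
    (hanti : StrictAntiOn z P) (hz : ∀ q ∈ P, 0 < z q) :
    ∃ (ρ : ℝ → ℝ≥0∞) (a b : ℝ), Measurable ρ ∧ a ∈ P ∧ (∀ q ∈ P, a ≤ q) ∧ a < b ∧
      (∀ t ∈ Set.Ioc a b, ρ t ≠ 0) ∧ (∀ t ∉ Set.Ioc a b, ρ t = 0) ∧
      ∀ q ∈ P, ∫⁻ t in Set.Ioi q, ρ t = ENNReal.ofReal (z q) := by
  induction P using Finset.induction_on_min with
  | empty => exact absurd hP Finset.not_nonempty_empty
  | insert m s hm ih =>
    rcases s.eq_empty_or_nonempty with rfl | hs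
    · have hzm : 0 < z m := hz m (by simp)
      refine ⟨(Set.Ioc m (m + 1)).indicator fun _ => ENNReal.ofReal (z m), m, m + 1,
        measurable_const.indicator measurableSet_Ioc, by simp, by simp, by linarith,
        fun t ht => ?_, fun t ht => Set.indicator_of_notMem ht _, fun q hq => ?_⟩
      · rw [Set.indicator_of_mem ht]
        simpa using hzm
      · have hqm : q = m := by simpa using hq
        subst hqm
        rw [setLIntegral_indicator measurableSet_Ioc,
          Set.inter_eq_left.2 Set.Ioc_subset_Ioi_self, setLIntegral_const, Real.volume_Ioc]
        simp
    · have hsub : (s : Set ℝ) ⊆ (insert m s : Finset ℝ) := by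
        intro q hq
        exact Finset.mem_insert_of_mem hq
      obtain ⟨ρ, a, b, hρ, has, hle, hab, hpos, hzero, htail⟩ :=
        ih hs (hanti.mono hsub) fun q hq => hz q (hsub hq)
      have hma : m < a := hm a has
      have hzma : z a < z m := hanti (by simp) (hsub has) hma
      have hza : 0 < z a := hz a (hsub has)
      -- The constant density that gives `(m, a]` the missing mass `z m - z a`.
      set c : ℝ := (z m - z a) / (a - m) with hc
      have hcpos : 0 < c := div_pos (sub_pos.2 hzma) (sub_pos.2 hma)
      have hnew : ∀ t, a < t → (Set.Ioc m a).indicator (fun _ => ENNReal.ofReal c) t = 0 :=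
        fun t ht => Set.indicator_of_notMem (fun h => ht.not_ge h.2) _
      have hmeas : Measurable ((Set.Ioc m a).indicator fun _ => ENNReal.ofReal c) :=
        measurable_const.indicator measurableSet_Ioc
      refine ⟨fun t => ρ t + (Set.Ioc m a).indicator (fun _ => ENNReal.ofReal c) t, m, b,
        hρ.add hmeas, by simp, ?_, hma.trans hab, fun t ht => ?_, fun t ht => ?_, fun q hq => ?_⟩
      · intro q hq
        rcases Finset.mem_insert.1 hq with rfl | hq
        · exact le_rfl
        · exact (hm q hq).le
      · by_cases hta : t ≤ a
        · beta_reduce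
          rw [Set.indicator_of_mem (show t ∈ Set.Ioc m a from ⟨ht.1, hta⟩)]
          simpa using fun _ : ρ t = 0 => hcpos
        · exact fun h => hpos t ⟨not_le.1 hta, ht.2⟩ (add_eq_zero.1 h).1
      · beta_reduce
        rw [hzero t fun h => ht ⟨hma.trans h.1, h.2⟩,
          Set.indicator_of_notMem fun h => ht ⟨h.1, h.2.trans hab.le⟩, add_zero]
      · rw [lintegral_add_left hρ]
        rcases Finset.mem_insert.1 hq with rfl | hq
        · have h1 : ∫⁻ t in Set.Ioi q, ρ t = ENNReal.ofReal (z a) := by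
            rw [← htail a has, ← lintegral_indicator measurableSet_Ioi,
              ← lintegral_indicator measurableSet_Ioi]
            congr 1
            ext t
            by_cases hta : a < t
            · rw [Set.indicator_of_mem (Set.mem_Ioi.2 (hma.trans hta)),
                Set.indicator_of_mem (Set.mem_Ioi.2 hta)]
            · rw [Set.indicator_of_notMem (mt Set.mem_Ioi.1 hta)]
              simp [Set.indicator_apply, hzero t fun h => hta h.1]
          rw [h1, setLIntegral_indicator measurableSet_Ioc,
            Set.inter_eq_left.2 Set.Ioc_subset_Ioi_self, setLIntegral_const, Real.volume_Ioc,
            ← ENNReal.ofReal_mul hcpos.le, ← ENNReal.ofReal_add hza.le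
              (mul_nonneg hcpos.le (sub_pos.2 hma).le), hc,
            div_mul_cancel₀ _ (sub_pos.2 hma).ne']
          congr 1
          ring
        · rw [htail q hq, setLIntegral_congr_fun (g := fun _ => 0) measurableSet_Ioi
            fun t ht => hnew t ((hle q hq).trans_lt ht)]
          simp

/-- There is a marginal law with prescribed strictly decreasing tail probabilities at finitely
many points. -/
lemma exists_isMarginal_tail_eq (P : Finset ℝ) (z : ℝ → ℝ)
    (hanti : StrictAntiOn z P) (hz : ∀ q ∈ P, 0 < z q) (hz1 : ∀ q ∈ P, z q ≤ 1) :
    ∃ μ : Measure ℝ, IsMarginal μ ∧ ∀ q ∈ P, μ.real (Set.Ioi q) = z q := by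
  obtain ⟨P', z', hPP', hzz', hanti', hz', q₀, hq₀, hq₀1⟩ :
      ∃ (P' : Finset ℝ) (z' : ℝ → ℝ), P ⊆ P' ∧ (∀ q ∈ P, z' q = z q) ∧ StrictAntiOn z' P' ∧
        (∀ q ∈ P', 0 < z' q ∧ z' q ≤ 1) ∧ ∃ q ∈ P', z' q = 1 := by
    by_cases h1 : ∃ q ∈ P, z q = 1
    · exact ⟨P, z, subset_rfl, fun _ _ => rfl, hanti, fun q hq => ⟨hz q hq, hz1 q hq⟩, h1⟩
    · push Not at h1
      -- The total mass must be one, so an extra point with tail 1 is added to the left of `P`.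
      obtain ⟨m, hm⟩ : ∃ m : ℝ, ∀ q ∈ P, m < q := by
        obtain ⟨m, hm⟩ := P.finite_toSet.bddBelow
        exact ⟨m - 1, fun q hq => by have := hm hq; linarith⟩
      have hlt : ∀ q ∈ P, z q < 1 := fun q hq => lt_of_le_of_ne (hz1 q hq) (h1 q hq)
      have hup : ∀ q ∈ P, Function.update z m 1 q = z q := fun q hq =>
        Function.update_of_ne (hm q hq).ne' _ _
      refine ⟨insert m P, Function.update z m 1, Finset.subset_insert _ _, hup, ?_, ?_,
        m, by simp, by simp⟩
      · intro q hq r hr hqr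
        rcases Finset.mem_insert.1 hq with rfl | hq' <;> rcases Finset.mem_insert.1 hr with rfl | hr'
        · exact absurd hqr (lt_irrefl _)
        · rw [hup r hr', Function.update_self]
          exact hlt r hr'
        · exact absurd hqr (hm q hq').not_gt
        · rw [hup q hq', hup r hr']
          exact hanti hq' hr' hqr
      · intro q hq
        rcases Finset.mem_insert.1 hq with rfl | hq
        · simp
        · rw [hup q hq]
          exact ⟨hz q hq, hz1 q hq⟩
  obtain ⟨ρ, a, b, hρ, ha, hle, hab, hpos, hzero, htail⟩ :=
    exists_density_tail_eq P' ⟨q₀, hq₀⟩ z' hanti' fun q hq => (hz' q hq).1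
  have hza : z' a = 1 := le_antisymm (hz' a ha).2
    (hq₀1 ▸ hanti'.antitoneOn ha hq₀ (hle q₀ hq₀))
  have hone : ∫⁻ t, ρ t = 1 := by
    have h := htail a ha
    rw [hza, ENNReal.ofReal_one] at h
    rw [← h]
    refine (setLIntegral_eq_of_support_subset fun t ht => ?_).symm
    exact (by_contra fun h => ht (hzero t h) : t ∈ Set.Ioc a b).1
  refine ⟨_, isMarginal_withDensity hpos hzero hρ hone, fun q hq => ?_⟩
  rw [measureReal_def, withDensity_apply _ measurableSet_Ioi, htail q (hPP' hq), hzz' q hq,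
    ENNReal.toReal_ofReal (hz q hq).le]

end Interpolation

/-! ### Feasibility and representability via ordered multipliers -/

section Feasibility

variable {n : ℕ} {𝒮 : Finset (Finset (Fin n))} {ε : ℝ} {x : ChoiceVec 𝒮}

lemma exists_isFeasible_of_le_imp_le {α : Type*} [LinearOrder α] (v : 𝒮 → α)
    (hx : ∀ S, x S ∈ stdSimplex ℝ S.1)
    (hv : ∀ (S T : 𝒮) (i : Fin n) (hS : i ∈ S.1) (hT : i ∈ T.1), v S ≤ v T →
      x T ⟨i, hT⟩ ≤ x S ⟨i, hS⟩)
    (hε : ε ≤ 1 / (𝒮.card : ℝ)) : ∃ lam δ, IsFeasible ε x lam δ := by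
  classical
  -- The ranks run from 0 to at most |𝒮| - 1. Divided by |𝒮| they stay in [0, 1], and distinct ones
  -- differ by at least 1/|𝒮| ≥ ε.
  set r : 𝒮 → ℕ := fun S => (Finset.univ.filter fun T => v T < v S).card with hr
  have hr_lt : ∀ S, r S < 𝒮.card := by
    intro S
    rw [← Fintype.card_coe 𝒮, ← Finset.card_univ]
    refine Finset.card_lt_card (Finset.filter_ssubset.2 ⟨S, Finset.mem_univ _, lt_irrefl _⟩)
  have hr_mono : ∀ S T, v S ≤ v T → r S ≤ r T := by
    intro S T h
    refine Finset.card_le_card fun U hU => ?_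
    rw [Finset.mem_filter] at hU ⊢
    exact ⟨hU.1, hU.2.trans_le h⟩
  have hr_strict : ∀ S T, v S < v T → r S + 1 ≤ r T := by
    intro S T h
    refine Finset.card_lt_card ⟨fun U hU => ?_, fun hsub => ?_⟩
    · rw [Finset.mem_filter] at hU ⊢
      exact ⟨hU.1, hU.2.trans h⟩
    · have := hsub (Finset.mem_filter.2 ⟨Finset.mem_univ S, h⟩)
      exact lt_irrefl _ (Finset.mem_filter.1 this).2
  set N : ℝ := (𝒮.card : ℝ) with hN
  have hlam0 : ∀ S, 0 ≤ (r S : ℝ) / N := fun S => by positivity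
  have hlam1 : ∀ S, (r S : ℝ) / N ≤ 1 := fun S =>
    div_le_one_of_le₀ (Nat.cast_le.2 (hr_lt S).le) (by positivity)
  have hmono : ∀ S T, v S ≤ v T → (r S : ℝ) / N ≤ r T / N := fun S T h =>
    div_le_div_of_nonneg_right (by exact_mod_cast hr_mono S T h) (by positivity)
  have hgap : ∀ S T, v S < v T → (r S : ℝ) / N + ε ≤ r T / N := by
    intro S T h
    have h1 : ((r S : ℝ) + 1) / N ≤ r T / N :=
      div_le_div_of_nonneg_right (by exact_mod_cast hr_strict S T h) (by positivity)
    rw [add_div] at h1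
    linarith
  have hx1 : ∀ S (i : S.1), x S i ≤ 1 := fun S i => (mem_Icc_of_mem_stdSimplex (hx S) i).2
  have hx0 : ∀ S (i : S.1), 0 ≤ x S i := fun S => (hx S).1
  refine ⟨fun S => r S / N, fun S T => if v S < v T then 1 else 0, ?_, ?_, ?_, ?_, ?_, ?_,
    fun S => (hx S).2, hx0, hlam0, hlam1, ?_⟩
  · intro S T i _ _
    split_ifs with h
    · linarith [hlam0 S, hlam1 T]
    · linarith [hmono T S (not_lt.1 h)]
  · intro S T i _ _
    split_ifs with h
    · linarith [hgap S T h]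
    · linarith [hlam0 T, hlam1 S]
  · intro S T i hS hT
    split_ifs with h
    · linarith [hv S T i hS hT h.le]
    · linarith [hx0 S ⟨i, hS⟩, hx1 T ⟨i, hT⟩]
  · intro S T i hS hT
    split_ifs with h
    · linarith [hv T S i hT hS h.le]
    · linarith [hx0 T ⟨i, hT⟩, hx1 S ⟨i, hS⟩]
  · intro S T i hS hT
    split_ifs with h1 h2 h2
    · exact absurd h1 h2.not_gt
    · linarith [hv S T i hS hT h1.le]
    · linarith [hx0 S ⟨i, hS⟩, hx1 T ⟨i, hT⟩]
    · linarith [hv S T i hS hT (not_lt.1 h2)]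
  · intro S T i hS hT
    split_ifs with h1 h2 h2
    · exact absurd h1 h2.not_gt
    · linarith [hx0 T ⟨i, hT⟩, hx1 S ⟨i, hS⟩]
    · linarith [hv T S i hT hS h2.le]
    · linarith [hv T S i hT hS (not_lt.1 h1)]
  · intro S T
    split_ifs
    · exact Or.inr rfl
    · exact Or.inl rfl

lemma IsFeasible.mem_stdSimplex {lam : 𝒮 → ℝ} {δ : 𝒮 → 𝒮 → ℝ} (h : IsFeasible ε x lam δ)
    (S : 𝒮) : x S ∈ stdSimplex ℝ S.1 := ⟨h.nonneg S, h.sum_eq_one S⟩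

/-- The strict inequality excludes `δ T S = 1` by monotonicity and `δ S T = δ T S = 0` by the tie
constraint; `δ S T = 1` gives the gap. -/
lemma IsFeasible.add_le_of_lt {lam : 𝒮 → ℝ} {δ : 𝒮 → 𝒮 → ℝ} (h : IsFeasible ε x lam δ)
    {S T : 𝒮} {i : Fin n} (hS : i ∈ S.1) (hT : i ∈ T.1) (hlt : x T ⟨i, hT⟩ < x S ⟨i, hS⟩) :
    lam S + ε ≤ lam T := by
  have h1 := h.mono_upper S T i hS hT
  have h2 := h.tie_upper S T i hS hT
  have h3 := h.order_upper S T i hS hT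
  rcases h.binary T S with hTS | hTS
  · rcases h.binary S T with hST | hST
    · rw [hTS, hST] at h2
      linarith
    · rw [hST] at h3
      linarith
  · rw [hTS] at h1
    linarith

lemma exists_isFeasible_of_mem_representable (hne : ∀ S : 𝒮, S.1.Nonempty)
    (hx : x ∈ representable 𝒮) (hε : ε ≤ 1 / (𝒮.card : ℝ)) :
    (∀ S, x S ∈ stdSimplex ℝ S.1) ∧ ∃ lam δ, IsFeasible ε x lam δ := by
  obtain ⟨F, ν, hF, hθ⟩ := hx
  choose θ hext hprob using hθ
  have hprobF := fun i => (hF i).isProbabilityMeasure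
  have hlarge : ∀ S : 𝒮, 1 < S.1.card → ∃ l : ℝ,
      ∑ i ∈ S.1, (F i).real (Set.Ioi (l - ν i)) = 1 := fun S hS =>
    exists_sum_tail_eq_one hF hS
  choose l hl using hlarge
  have hx_large : ∀ (S : 𝒮) (hS : 1 < S.1.card) (i : S.1),
      x S i = (F i).real (Set.Ioi (l S hS - ν i)) := fun S hS i => by
    rw [hprob S i, (hext S).choiceProb_eq hF (hl S hS) i.2]
  have hx_small : ∀ (S : 𝒮), ¬ 1 < S.1.card → ∀ i : S.1, x S i = 1 := by
    intro S hS i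
    have := (hext S).1.1
    have hset : {e : Fin n → ℝ | ∀ j ∈ S.1, j ≠ i → ν j + e j < ν i + e i} = Set.univ := by
      refine Set.eq_univ_of_forall fun e j hj hji => ?_
      exact absurd (Finset.card_le_one.1 (not_lt.1 hS) j hj i i.2) hji
    rw [hprob S i, choiceProb, hset, probReal_univ]
  have hsimplex : ∀ S, x S ∈ stdSimplex ℝ S.1 := by
    intro S
    by_cases hS : 1 < S.1.card
    · refine ⟨fun i => by rw [hx_large S hS i]; exact measureReal_nonneg, ?_⟩
      rw [← hl S hS, ← Finset.sum_coe_sort S.1 fun i => (F i).real (Set.Ioi (l S hS - ν i))]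
      exact Finset.sum_congr rfl fun i _ => hx_large S hS i
    · refine ⟨fun i => by rw [hx_small S hS i]; exact zero_le_one, ?_⟩
      have hcard : S.1.card = 1 :=
        le_antisymm (not_lt.1 hS) (Finset.card_pos.2 (hne S))
      rw [Finset.sum_congr rfl fun i _ => hx_small S hS i]
      simp [hcard]
  -- A singleton may have no real multiplier; its choice probability is 1, so `⊥` is consistent with
  -- antitonicity.
  refine ⟨hsimplex, exists_isFeasible_of_le_imp_le
    (fun S => if h : 1 < S.1.card then ((l S h : ℝ) : WithBot ℝ) else ⊥) hsimplex ?_ hε⟩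
  intro S T i hS hT hle
  by_cases hS1 : 1 < S.1.card
  · by_cases hT1 : 1 < T.1.card
    · rw [dif_pos hS1, dif_pos hT1, WithBot.coe_le_coe] at hle
      rw [hx_large S hS1, hx_large T hT1]
      exact measureReal_mono (Set.Ioi_subset_Ioi (by linarith))
    · rw [dif_pos hS1, dif_neg hT1, le_bot_iff] at hle
      exact absurd hle (WithBot.coe_ne_bot)
  · rw [hx_small S hS1]
    exact (mem_Icc_of_mem_stdSimplex (hsimplex T) _).2

lemma mem_representable_of_strictAnti (hx : ∀ S, x S ∈ stdSimplex ℝ S.1)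
    (hne : ∀ S : 𝒮, S.1.Nonempty) (hpos : ∀ S i, 0 < x S i) (l : 𝒮 → ℝ)
    (hlt : ∀ (S T : 𝒮) (i : Fin n) (hS : i ∈ S.1) (hT : i ∈ T.1), l S < l T →
      x T ⟨i, hT⟩ < x S ⟨i, hS⟩)
    (heq : ∀ (S T : 𝒮) (i : Fin n) (hS : i ∈ S.1) (hT : i ∈ T.1), l S = l T →
      x S ⟨i, hS⟩ = x T ⟨i, hT⟩) : x ∈ representable 𝒮 := by
  classical
  have hmarg : ∀ i : Fin n, ∃ μ : Measure ℝ, IsMarginal μ ∧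
      ∀ (S : 𝒮) (hS : i ∈ S.1), μ.real (Set.Ioi (l S)) = x S ⟨i, hS⟩ := by
    intro i
    -- By `heq` the value does not depend on the chosen assortment; the default 0 is never taken at
    -- the interpolation points.
    set z : ℝ → ℝ := fun q =>
      if h : ∃ S : 𝒮, i ∈ S.1 ∧ l S = q then x h.choose ⟨i, h.choose_spec.1⟩ else 0 with hz
    have hzl : ∀ (S : 𝒮) (hS : i ∈ S.1), z (l S) = x S ⟨i, hS⟩ := by
      intro S hS
      have h : ∃ T : 𝒮, i ∈ T.1 ∧ l T = l S := ⟨S, hS, rfl⟩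
      rw [hz]
      simp only [dif_pos h]
      exact heq _ _ i h.choose_spec.1 hS h.choose_spec.2
    have hmem : ∀ q ∈ (Finset.univ.filter fun S : 𝒮 => i ∈ S.1).image l,
        ∃ (S : 𝒮) (_ : i ∈ S.1), l S = q := by
      intro q hq
      obtain ⟨S, hS, rfl⟩ := Finset.mem_image.1 hq
      exact ⟨S, (Finset.mem_filter.1 hS).2, rfl⟩
    refine (exists_isMarginal_tail_eq ((Finset.univ.filter fun S : 𝒮 => i ∈ S.1).image l) z
      ?_ ?_ ?_).imp fun μ ⟨hμ, htail⟩ => ⟨hμ, fun S hS => ?_⟩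
    rotate_right
    · rw [htail _ (Finset.mem_image_of_mem l (Finset.mem_filter.2 ⟨Finset.mem_univ S, hS⟩)),
        hzl S hS]
    · intro q hq r hr hqr
      obtain ⟨S, hS, rfl⟩ := hmem q hq
      obtain ⟨T, hT, rfl⟩ := hmem r hr
      rw [hzl S hS, hzl T hT]
      exact hlt S T i hS hT hqr
    · intro q hq
      obtain ⟨S, hS, rfl⟩ := hmem q hq
      rw [hzl S hS]
      exact hpos S _
    · intro q hq
      obtain ⟨S, hS, rfl⟩ := hmem q hq
      rw [hzl S hS]
      exact (mem_Icc_of_mem_stdSimplex (hx S) _).2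
  choose F hF htail using hmarg
  -- The marginals absorb any shift, so `ν = 0` suffices.
  refine ⟨F, 0, hF, fun S => ?_⟩
  have hsum : ∑ i ∈ S.1, (F i).real (Set.Ioi (l S - (0 : Fin n → ℝ) i)) = 1 := by
    rw [← (hx S).2,
      ← Finset.sum_coe_sort S.1 fun i => (F i).real (Set.Ioi (l S - (0 : Fin n → ℝ) i))]
    refine Finset.sum_congr rfl fun i _ => ?_
    rw [Pi.zero_apply, sub_zero, htail i S i.2]
  obtain ⟨θ, hθ, hch⟩ := exists_isExtremal hF (hne S) hsum
  refine ⟨θ, hθ, fun i => ?_⟩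
  rw [hch i i.2, Pi.zero_apply, sub_zero, htail i S i.2]

end Feasibility

/-! ### Perturbing feasible vectors into representable ones -/

section Perturbation

open Filter Topology

variable {n : ℕ} {𝒮 : Finset (Finset (Fin n))} {ε : ℝ} {x : ChoiceVec 𝒮} {lam : 𝒮 → ℝ}

/-- The largest multiplier among the assortments in which the product `i` has choice
probability `w`. -/
noncomputable def classSup (x : ChoiceVec 𝒮) (lam : 𝒮 → ℝ) (i : Fin n) (w : ℝ) : ℝ :=
  sSup (lam '' {T | ∃ hT : i ∈ T.1, x T ⟨i, hT⟩ = w})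

lemma le_classSup (S : 𝒮) (i : S.1) : lam S ≤ classSup x lam i (x S i) :=
  le_csSup ((Set.toFinite _).image _).bddAbove ⟨S, ⟨i.2, rfl⟩, rfl⟩

lemma classSup_le (S : 𝒮) (i : S.1) {b : ℝ}
    (hb : ∀ (T : 𝒮) (hT : i.1 ∈ T.1), x T ⟨i, hT⟩ = x S i → lam T ≤ b) :
    classSup x lam i (x S i) ≤ b := by
  refine csSup_le ⟨_, S, ⟨i.2, rfl⟩, rfl⟩ ?_
  rintro _ ⟨T, ⟨hT, h⟩, rfl⟩
  exact hb T hT h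

/-- A strictly decreasing function of `l`, steep beyond `u` when `w > 0`. -/
noncomputable def steepSlope (K u w l : ℝ) : ℝ :=
  3 - l - if 0 < w then K * max (l - u) 0 else 0

lemma steepSlope_strictAnti {K : ℝ} (hK : 0 ≤ K) (u w : ℝ) : StrictAnti (steepSlope K u w) := by
  intro a b hab
  unfold steepSlope
  split_ifs
  · have : K * max (a - u) 0 ≤ K * max (b - u) 0 := by gcongr
    linarith
  · linarith

lemma continuous_steepSlope (K u w : ℝ) : Continuous (steepSlope K u w) := by
  unfold steepSlope
  split_ifs <;> fun_prop

/-- At `u k` no penalty is active and each term is at least 2. At `u k + ε / 2` the penalty of `k`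
alone is `K * ε / 2`, at least three times the number of terms, and each term is at most 3 before
penalties. The sum vanishes in between. -/
lemma exists_root_steepSlope {ι : Type*} [Fintype ι] {u w : ι → ℝ} {k : ι} {K : ℝ}
    (hε : 0 < ε) (hk : 0 < w k) (hkmin : ∀ i, 0 < w i → u k ≤ u i) (hu0 : 0 ≤ u k)
    (hu1 : u k ≤ 1) (hK0 : 0 ≤ K) (hK : 6 * (Fintype.card ι : ℝ) ≤ K * ε) :
    ∃ l ∈ Set.Icc (u k) (u k + ε / 2), ∑ i, steepSlope K (u i) (w i) l = 0 := by
  have hcont : Continuous fun l => ∑ i, steepSlope K (u i) (w i) l :=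
    continuous_finsetSum _ fun i _ => continuous_steepSlope K (u i) (w i)
  have hlow : 0 ≤ ∑ i, steepSlope K (u i) (w i) (u k) := by
    refine Finset.sum_nonneg fun i _ => ?_
    unfold steepSlope
    split_ifs with h
    · rw [max_eq_right (sub_nonpos.2 (hkmin i h)), mul_zero]
      linarith
    · linarith
  have hhigh : ∑ i, steepSlope K (u i) (w i) (u k + ε / 2) ≤ 0 := by
    have hpen : ∀ i, 0 ≤ if 0 < w i then K * max (u k + ε / 2 - u i) 0 else 0 := by
      intro i
      split_ifs
      · exact mul_nonneg hK0 (le_max_right _ _)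
      · exact le_rfl
    have hpen_k : (if 0 < w k then K * max (u k + ε / 2 - u k) 0 else 0) = K * ε / 2 := by
      rw [if_pos hk, add_sub_cancel_left, max_eq_left (by linarith)]
      ring
    have h1 := Finset.single_le_sum (fun i _ => hpen i) (Finset.mem_univ k)
    rw [hpen_k] at h1
    have h2 : (Fintype.card ι : ℝ) * (3 - (u k + ε / 2)) ≤ Fintype.card ι * 3 := by
      gcongr
      linarith
    simp only [steepSlope, Finset.sum_sub_distrib (fun _ => 3 - (u k + ε / 2)),
      Finset.sum_const, Finset.card_univ, nsmul_eq_mul]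
    linarith
  exact intermediate_value_Icc' (by linarith) hcont.continuousOn ⟨hhigh, hlow⟩

lemma exists_root_classSup (hε : 0 < ε) (hx : ∀ S, x S ∈ stdSimplex ℝ S.1)
    (hlam0 : ∀ S, 0 ≤ lam S) (hlam1 : ∀ S, lam S ≤ 1) (S : 𝒮) {K : ℝ} (hK : 6 * n ≤ K * ε)
    (hK0 : 0 ≤ K) :
    ∃ l, lam S ≤ l ∧ l ≤ 1 + ε / 2 ∧
      (∀ i : S.1, 0 < x S i → l ≤ classSup x lam i (x S i) + ε / 2) ∧
      ∑ i : S.1, steepSlope K (classSup x lam i (x S i)) (x S i) l = 0 := by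
  obtain ⟨k₀, hk₀⟩ : ∃ i, 0 < x S i := by
    by_contra! h
    have := Finset.sum_nonpos fun i (_ : i ∈ Finset.univ) => h i
    rw [(hx S).2] at this
    linarith
  -- With the least class supremum as base point, the root is within `ε / 2` of a lower bound for
  -- all classes of positive probability.
  obtain ⟨k, hk, hkmin⟩ := Finset.exists_min_image (Finset.univ.filter fun i => 0 < x S i)
    (fun i => classSup x lam i (x S i)) ⟨k₀, by simpa using hk₀⟩
  simp only [Finset.mem_filter, Finset.mem_univ, true_and] at hk hkmin
  have hSm : lam S ≤ classSup x lam k (x S k) := le_classSup S k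
  have hm1 : classSup x lam k (x S k) ≤ 1 := classSup_le S k fun T _ _ => hlam1 T
  have hcard : (Fintype.card S.1 : ℝ) ≤ n := by
    have : Fintype.card S.1 ≤ n := by simpa using Finset.card_le_univ S.1
    exact_mod_cast this
  obtain ⟨l, ⟨hl1, hl2⟩, hl⟩ := exists_root_steepSlope
    (u := fun i : S.1 => classSup x lam i (x S i)) (w := x S) hε hk hkmin
    ((hlam0 S).trans hSm) hm1 hK0 (by linarith)
  exact ⟨l, hSm.trans hl1, by linarith, fun i hi => by linarith [hkmin i hi], hl⟩

/-- Every feasible vector `x` is the endpoint of a segment along which all products have positive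
and strictly monotone choice probabilities. -/
lemma exists_strictAnti_perturbation (hε : 0 < ε) (hε1 : ε ≤ 1)
    (hx : ∀ S, x S ∈ stdSimplex ℝ S.1)
    (hlam0 : ∀ S, 0 ≤ lam S) (hlam1 : ∀ S, lam S ≤ 1)
    (hgap : ∀ (S T : 𝒮) (i : Fin n) (hS : i ∈ S.1) (hT : i ∈ T.1),
      x T ⟨i, hT⟩ < x S ⟨i, hS⟩ → lam S + ε ≤ lam T) :
    ∃ (y : ChoiceVec 𝒮) (l : 𝒮 → ℝ), (∀ S, y S ∈ stdSimplex ℝ S.1) ∧ (∀ S i, 0 < y S i) ∧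
      (∀ (S T : 𝒮) (i : Fin n) (hS : i ∈ S.1) (hT : i ∈ T.1), l S < l T →
        y T ⟨i, hT⟩ < y S ⟨i, hS⟩ ∧ x T ⟨i, hT⟩ ≤ x S ⟨i, hS⟩) ∧
      (∀ (S T : 𝒮) (i : Fin n) (hS : i ∈ S.1) (hT : i ∈ T.1), l S = l T →
        y S ⟨i, hS⟩ = y T ⟨i, hT⟩ ∧ x S ⟨i, hS⟩ = x T ⟨i, hT⟩) := by
  have hK0 : (0 : ℝ) ≤ 6 * n / ε := by positivity
  choose l hl0 hl1 hl2 hlsum using fun S => exists_root_classSup hε hx hlam0 hlam1 S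
    (div_mul_cancel₀ (6 * (n : ℝ)) hε.ne').ge hK0
  set g : ChoiceVec 𝒮 := fun S i =>
    steepSlope (6 * n / ε) (classSup x lam i (x S i)) (x S i) (l S) with hg
  have hlt : ∀ (S T : 𝒮) (i : Fin n) (hS : i ∈ S.1) (hT : i ∈ T.1),
      x T ⟨i, hT⟩ < x S ⟨i, hS⟩ → l S < l T := by
    intro S T i hS hT h
    have h1 := hl2 S ⟨i, hS⟩ (((hx T).1 _).trans_lt h)
    -- The gap applies to every assortment in the class of `S`, so the class supremum is at most
    -- `lam T - ε`. As `l S` exceeds it by at most `ε / 2`, it stays below `lam T ≤ l T`.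
    have h2 : classSup x lam i (x S ⟨i, hS⟩) ≤ lam T - ε :=
      classSup_le S ⟨i, hS⟩ fun A hA hAS => by
        have := hgap A T i hA hT (by simpa only [hAS] using h)
        linarith
    have h3 := hl0 T
    simp only at h1
    linarith
  have hev_pos : ∀ S i, ∀ᶠ t in 𝓝[>] (0 : ℝ), 0 < x S i + t * g S i := by
    intro S i
    rcases ((hx S).1 i).lt_or_eq with h | h
    · have hc : Tendsto (fun t : ℝ => x S i + t * g S i) (𝓝[>] 0) (𝓝 (x S i + 0 * g S i)) :=
        ((by fun_prop : Continuous fun t : ℝ => x S i + t * g S i).tendsto 0).mono_left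
          nhdsWithin_le_nhds
      exact hc.eventually_const_lt (by simpa using h)
    · filter_upwards [self_mem_nhdsWithin] with t ht
      -- For a zero entry the penalty is absent, and `3 - l S > 0` because `l S ≤ 1 + ε / 2`.
      have hgpos : 0 < g S i := by
        simp only [hg, steepSlope, ← h, lt_irrefl, if_false]
        linarith [hl1 S]
      rw [← h, zero_add]
      exact mul_pos ht hgpos
  have hev_lt : ∀ S T (i : S.1) (j : T.1), ∀ᶠ t in 𝓝[>] (0 : ℝ), x T j < x S i →
      x T j + t * g T j < x S i + t * g S i := by
    intro S T i j
    by_cases h : x T j < x S i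
    · have hc : Tendsto (fun t : ℝ => (x S i + t * g S i) - (x T j + t * g T j)) (𝓝[>] 0)
          (𝓝 ((x S i + 0 * g S i) - (x T j + 0 * g T j))) :=
        ((by fun_prop : Continuous fun t : ℝ =>
          (x S i + t * g S i) - (x T j + t * g T j)).tendsto 0).mono_left nhdsWithin_le_nhds
      filter_upwards [hc.eventually_const_lt (u := 0) (by simpa using h)] with t ht _
      linarith
    · exact Eventually.of_forall fun t ht => absurd ht h
  obtain ⟨t, ⟨ht_pos, ht_lt⟩, ht0⟩ := (((eventually_all.2 fun S => eventually_all.2 fun i =>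
    hev_pos S i).and (eventually_all.2 fun S => eventually_all.2 fun T => eventually_all.2 fun i =>
    eventually_all.2 fun j => hev_lt S T i j)).and self_mem_nhdsWithin).exists
  have ht0 : 0 < t := ht0
  refine ⟨fun S i => x S i + t * g S i, l, fun S => ⟨fun i => (ht_pos S i).le, ?_⟩, ht_pos,
    fun S T i hS hT h => ?_, fun S T i hS hT h => ?_⟩
  · rw [Finset.sum_add_distrib, ← Finset.mul_sum, (hx S).2, hlsum S, mul_zero, add_zero]
  · have hle : x T ⟨i, hT⟩ ≤ x S ⟨i, hS⟩ :=
      not_lt.1 fun h' => h.not_gt (hlt T S i hT hS h')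
    refine ⟨?_, hle⟩
    rcases hle.lt_or_eq with h' | h'
    · exact ht_lt S T _ _ h'
    · have : g T ⟨i, hT⟩ < g S ⟨i, hS⟩ := by
        simp only [hg, h']
        exact steepSlope_strictAnti hK0 _ _ h
      simp only [h']
      gcongr
  · have heq : x S ⟨i, hS⟩ = x T ⟨i, hT⟩ :=
      le_antisymm (not_lt.1 fun h' => h.not_lt (hlt S T i hS hT h'))
        (not_lt.1 fun h' => h.not_gt (hlt T S i hT hS h'))
    refine ⟨?_, heq⟩
    simp only [hg, heq, h]

lemma IsFeasible.exists_segment {δ : 𝒮 → 𝒮 → ℝ} (h : IsFeasible ε x lam δ) (hε : 0 < ε)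
    (hε1 : ε ≤ 1) (hne : ∀ S : 𝒮, S.1.Nonempty) :
    ∃ y : ChoiceVec 𝒮, (∀ S, y S ∈ stdSimplex ℝ S.1) ∧
      ∀ a b : ℝ, 0 ≤ a → 0 < b → a + b = 1 → a • x + b • y ∈ representable 𝒮 := by
  obtain ⟨y, l, hy, hypos, hlt, heq⟩ := exists_strictAnti_perturbation hε hε1 h.mem_stdSimplex
    h.lam_nonneg h.lam_le_one fun S T i hS hT => h.add_le_of_lt hS hT
  refine ⟨y, hy, fun a b ha hb hab => ?_⟩
  refine mem_representable_of_strictAnti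
    (fun S => convex_stdSimplex ℝ S.1 (h.mem_stdSimplex S) (hy S) ha hb.le hab) hne
    (fun S i => ?_) l (fun S T i hS hT hl => ?_) fun S T i hS hT hl => ?_
  · exact add_pos_of_nonneg_of_pos (mul_nonneg ha (h.nonneg S i)) (mul_pos hb (hypos S i))
  · obtain ⟨h1, h2⟩ := hlt S T i hS hT hl
    exact add_lt_add_of_le_of_lt (mul_le_mul_of_nonneg_left h2 ha)
      (mul_lt_mul_of_pos_left h1 hb)
  · obtain ⟨h1, h2⟩ := heq S T i hS hT hl
    simp only [Pi.add_apply, Pi.smul_apply, h1, h2]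

end Perturbation

/-! ### Passage to the limit, equality of infima and attainment -/

section Limit

open Filter Topology

variable {n : ℕ} {𝒮 : Finset (Finset (Fin n))} {ε : ℝ}

/-- For finite `f` the chord is an upper bound with limit `f x`. An infinite value at an endpoint
would make the chord useless; there continuity serves, with `f` along the segment as its own bound.
-/
lemma exists_tendsto_bound_of_convexOn {ι : Type*} [Fintype ι] {f : (ι → ℝ) → ℝ≥0∞}
    (hconv : ConvexOn ℝ≥0 (stdSimplex ℝ ι) f)
    (hreg : (∀ y ∈ stdSimplex ℝ ι, f y ≠ ∞) ∨ ContinuousOn f (stdSimplex ℝ ι))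
    {x y : ι → ℝ} (hx : x ∈ stdSimplex ℝ ι) (hy : y ∈ stdSimplex ℝ ι) :
    ∃ u : ℝ≥0 → ℝ≥0∞, Tendsto u (𝓝[>] 0) (𝓝 (f x)) ∧
      ∀ t ≤ 1, f (((1 - t : ℝ≥0) : ℝ) • x + (t : ℝ) • y) ≤ u t := by
  rcases hreg with hfin | hcont
  · refine ⟨fun t => (1 - t) • f x + t • f y, ?_, fun t ht =>
      hconv.2 hx hy zero_le zero_le (tsub_add_cancel_of_le ht)⟩
    have hc : Continuous fun t : ℝ≥0 => (1 - t) • f x + t • f y := by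
      simp only [ENNReal.smul_def, smul_eq_mul]
      refine Continuous.add ?_ ?_
      · exact (ENNReal.continuous_mul_const (hfin x hx)).comp
          (ENNReal.continuous_coe.comp (continuous_const.sub continuous_id))
      · exact (ENNReal.continuous_mul_const (hfin y hy)).comp ENNReal.continuous_coe
    have := (hc.tendsto 0).mono_left (nhdsWithin_le_nhds (s := Set.Ioi 0))
    simpa using this
  · refine ⟨fun t => f (((1 - t : ℝ≥0) : ℝ) • x + (t : ℝ) • y), ?_, fun _ _ => le_rfl⟩
    have hc : Continuous fun t : ℝ≥0 => ((1 - t : ℝ≥0) : ℝ) • x + (t : ℝ) • y := by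
      refine Continuous.fun_add (Continuous.fun_smul ?_ continuous_const)
        (NNReal.continuous_coe.fun_smul continuous_const)
      exact NNReal.continuous_coe.comp (continuous_const.sub continuous_id)
    have h0 : ((1 - (0 : ℝ≥0) : ℝ≥0) : ℝ) • x + ((0 : ℝ≥0) : ℝ) • y = x := by simp
    refine (hcont x hx).tendsto.comp (tendsto_nhdsWithin_iff.2 ⟨?_, ?_⟩)
    · have := (hc.tendsto 0).mono_left (nhdsWithin_le_nhds (s := Set.Ioi 0))
      rwa [h0] at this
    · have h1 : ∀ᶠ t : ℝ≥0 in 𝓝[>] 0, t < 1 := nhdsWithin_le_nhds (gt_mem_nhds one_pos)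
      filter_upwards [h1] with t ht
      refine convex_stdSimplex ℝ ι hx hy (NNReal.coe_nonneg _) (NNReal.coe_nonneg _) ?_
      rw [← NNReal.coe_add, tsub_add_cancel_of_le ht.le, NNReal.coe_one]

variable {loss : (S : 𝒮) → (S.1 → ℝ) → (S.1 → ℝ) → ℝ≥0∞} {p : ChoiceVec 𝒮}

lemma IsFeasible.limit_le {x : ChoiceVec 𝒮} {lam : 𝒮 → ℝ} {δ : 𝒮 → 𝒮 → ℝ}
    (h : IsFeasible ε x lam δ) (hε : 0 < ε) (hε1 : ε ≤ 1) (hne : ∀ S : 𝒮, S.1.Nonempty)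
    (hconv : ∀ S : 𝒮, ConvexOn ℝ≥0 (stdSimplex ℝ S.1) (loss S (p S)))
    (hreg : ∀ S : 𝒮, (∀ y ∈ stdSimplex ℝ S.1, loss S (p S) y ≠ ∞) ∨
      ContinuousOn (loss S (p S)) (stdSimplex ℝ S.1)) :
    limit loss p ≤ totalLoss loss p x := by
  obtain ⟨y, hy, hrep⟩ := h.exists_segment hε hε1 hne
  choose u hu hle using fun S =>
    exists_tendsto_bound_of_convexOn (hconv S) (hreg S) (h.mem_stdSimplex S) (hy S)
  have hsum : Tendsto (fun t => ∑ S, u S t) (𝓝[>] 0) (𝓝 (totalLoss loss p x)) :=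
    tendsto_finsetSum _ fun S _ => hu S
  refine ge_of_tendsto hsum ?_
  have h1 : ∀ᶠ t : ℝ≥0 in 𝓝[>] 0, t < 1 := nhdsWithin_le_nhds (gt_mem_nhds one_pos)
  filter_upwards [h1, self_mem_nhdsWithin] with t ht ht0
  have hmem := hrep ((1 - t : ℝ≥0) : ℝ) t (NNReal.coe_nonneg _) (NNReal.coe_pos.2 ht0)
    (by rw [← NNReal.coe_add, tsub_add_cancel_of_le ht.le, NNReal.coe_one])
  exact (sInf_le (Set.mem_image_of_mem (totalLoss loss p) hmem)).trans (Finset.sum_le_sum fun S _ => hle S t ht.le)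

lemma limit_eq_sInf_feasibleValues (hne : ∀ S : 𝒮, S.1.Nonempty)
    (hconv : ∀ S : 𝒮, ConvexOn ℝ≥0 (stdSimplex ℝ S.1) (loss S (p S)))
    (hreg : ∀ S : 𝒮, (∀ y ∈ stdSimplex ℝ S.1, loss S (p S) y ≠ ∞) ∨
      ContinuousOn (loss S (p S)) (stdSimplex ℝ S.1))
    (hε : 0 < ε) (hε1 : ε ≤ 1) (hε' : ε ≤ 1 / (𝒮.card : ℝ)) :
    limit loss p = sInf (feasibleValues loss p ε) := by
  refine le_antisymm (le_sInf ?_) (le_sInf ?_)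
  · rintro _ ⟨x, lam, δ, h, rfl⟩
    exact h.limit_le hε hε1 hne hconv hreg
  · rintro _ ⟨x, hx, rfl⟩
    obtain ⟨-, lam, δ, h⟩ := exists_isFeasible_of_mem_representable hne hx hε'
    exact sInf_le ⟨x, lam, δ, h, rfl⟩

variable (𝒮 ε) in
/-- The set of feasible points of the mixed-integer program. -/
def feasibleSet : Set (ChoiceVec 𝒮 × (𝒮 → ℝ) × (𝒮 → 𝒮 → ℝ)) :=
  {q | IsFeasible ε q.1 q.2.1 q.2.2}

lemma isClosed_feasibleSet : IsClosed (feasibleSet 𝒮 ε) := by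
  have hset : feasibleSet 𝒮 ε = {q |
      (∀ (S T : 𝒮) (i : Fin n), i ∈ S.1 → i ∈ T.1 → -q.2.2 S T ≤ q.2.1 S - q.2.1 T) ∧
      (∀ (S T : 𝒮) (i : Fin n), i ∈ S.1 → i ∈ T.1 →
        q.2.1 S - q.2.1 T ≤ 1 - (1 + ε) * q.2.2 S T) ∧
      (∀ (S T : 𝒮) (i : Fin n) (hS : i ∈ S.1) (hT : i ∈ T.1),
        q.2.2 S T - 1 ≤ q.1 S ⟨i, hS⟩ - q.1 T ⟨i, hT⟩) ∧
      (∀ (S T : 𝒮) (i : Fin n) (hS : i ∈ S.1) (hT : i ∈ T.1),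
        q.1 S ⟨i, hS⟩ - q.1 T ⟨i, hT⟩ ≤ 1 - q.2.2 T S) ∧
      (∀ (S T : 𝒮) (i : Fin n) (hS : i ∈ S.1) (hT : i ∈ T.1),
        -(q.2.2 S T + q.2.2 T S) ≤ q.1 S ⟨i, hS⟩ - q.1 T ⟨i, hT⟩) ∧
      (∀ (S T : 𝒮) (i : Fin n) (hS : i ∈ S.1) (hT : i ∈ T.1),
        q.1 S ⟨i, hS⟩ - q.1 T ⟨i, hT⟩ ≤ q.2.2 S T + q.2.2 T S) ∧
      (∀ S : 𝒮, ∑ i, q.1 S i = 1) ∧ (∀ (S : 𝒮) (i : S.1), 0 ≤ q.1 S i) ∧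
      (∀ S : 𝒮, 0 ≤ q.2.1 S) ∧ (∀ S : 𝒮, q.2.1 S ≤ 1) ∧
      ∀ S T : 𝒮, q.2.2 S T = 0 ∨ q.2.2 S T = 1} := by
    ext q
    exact ⟨fun h => ⟨h.1, h.2, h.3, h.4, h.5, h.6, h.7, h.8, h.9, h.10, h.11⟩,
      fun ⟨h1, h2, h3, h4, h5, h6, h7, h8, h9, h10, h11⟩ =>
        ⟨h1, h2, h3, h4, h5, h6, h7, h8, h9, h10, h11⟩⟩
  rw [hset]
  simp only [Set.ofPred_and, Set.ofPred_forall, Set.ofPred_or]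
  have hx : ∀ (S : 𝒮) (i : S.1),
      Continuous fun q : ChoiceVec 𝒮 × (𝒮 → ℝ) × (𝒮 → 𝒮 → ℝ) => q.1 S i := fun S i => by fun_prop
  repeat' first
    | apply IsClosed.inter
    | apply IsClosed.union
    | (refine isClosed_iInter fun _ => ?_)
    | (refine isClosed_le ?_ ?_ <;> fun_prop)
    | (refine isClosed_eq ?_ ?_ <;> fun_prop)

lemma isCompact_feasibleSet : IsCompact (feasibleSet 𝒮 ε) := by
  have hbox : IsCompact ((Set.univ.pi fun S : 𝒮 => stdSimplex ℝ S.1) ×ˢ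
      (Set.univ.pi fun _ : 𝒮 => Set.Icc (0 : ℝ) 1) ×ˢ
      (Set.univ.pi fun _ : 𝒮 => Set.univ.pi fun _ : 𝒮 => Set.Icc (0 : ℝ) 1)) :=
    (isCompact_univ_pi fun S => isCompact_stdSimplex ℝ S.1).prod
      ((isCompact_univ_pi fun _ => isCompact_Icc).prod
        (isCompact_univ_pi fun _ => isCompact_univ_pi fun _ => isCompact_Icc))
  refine hbox.of_isClosed_subset isClosed_feasibleSet fun q hq => ?_
  refine ⟨fun S _ => IsFeasible.mem_stdSimplex hq S,
    fun S _ => ⟨hq.lam_nonneg S, hq.lam_le_one S⟩, fun S _ T _ => ?_⟩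
  rcases hq.binary S T with h | h <;> simp [h]

lemma feasibleSet_nonempty (hne : ∀ S : 𝒮, S.1.Nonempty) (hε : ε ≤ 1 / (𝒮.card : ℝ)) :
    (feasibleSet 𝒮 ε).Nonempty := by
  have hpos : ∀ S : 𝒮, (0 : ℝ) < S.1.card := fun S => by exact_mod_cast (hne S).card_pos
  -- Uniform choice is feasible: its probabilities decrease with the size of the assortment.
  obtain ⟨lam, δ, h⟩ := exists_isFeasible_of_le_imp_le (ε := ε)
    (x := fun (S : 𝒮) (_ : S.1) => ((S.1.card : ℝ))⁻¹) (fun S => S.1.card)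
    (fun S => ⟨fun _ => (inv_pos.2 (hpos S)).le, by simp [(hpos S).ne']⟩)
    (fun S T i hS hT hle => inv_anti₀ (hpos S) (by exact_mod_cast hle)) hε
  exact ⟨(_, lam, δ), h⟩

lemma exists_isLeast_feasibleValues (hne : ∀ S : 𝒮, S.1.Nonempty) (hε : ε ≤ 1 / (𝒮.card : ℝ))
    (hcont : ∀ S : 𝒮, ContinuousOn (loss S (p S)) (stdSimplex ℝ S.1)) :
    ∃ v, IsLeast (feasibleValues loss p ε) v := by
  have hc : ContinuousOn (fun q : ChoiceVec 𝒮 × (𝒮 → ℝ) × (𝒮 → 𝒮 → ℝ) =>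
      totalLoss loss p q.1) (feasibleSet 𝒮 ε) := by
    refine continuousOn_finsetSum _ fun S _ => (hcont S).comp
      (by fun_prop : Continuous fun q : ChoiceVec 𝒮 × (𝒮 → ℝ) × (𝒮 → 𝒮 → ℝ) =>
        q.1 S).continuousOn fun q hq => IsFeasible.mem_stdSimplex hq S
  obtain ⟨q, hq, hmin⟩ := isCompact_feasibleSet.exists_isMinOn (feasibleSet_nonempty hne hε) hc
  refine ⟨_, ⟨q.1, q.2.1, q.2.2, hq, rfl⟩, ?_⟩
  rintro _ ⟨x, lam, δ, h, rfl⟩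
  exact hmin (show (x, lam, δ) ∈ feasibleSet 𝒮 ε from h)

end Limit

end MDM

/-! ### The main theorem -/

theorem proposition5 {n : ℕ} (𝒮 : Finset (Finset (Fin n)))
    (p : MDM.ChoiceVec 𝒮) (hp : ∀ S : 𝒮, p S ∈ stdSimplex ℝ S.1)
    (loss : (S : 𝒮) → (S.1 → ℝ) → (S.1 → ℝ) → ℝ≥0∞)
    (hconv : ∀ S : 𝒮, ConvexOn ℝ≥0 (stdSimplex ℝ S.1) (loss S (p S)))
    (hreg : ∀ S : 𝒮, (∀ y ∈ stdSimplex ℝ S.1, loss S (p S) y ≠ ∞) ∨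
      ContinuousOn (loss S (p S)) (stdSimplex ℝ S.1))
    (ε : ℝ) (hε : 0 < ε) (hε' : ε < 1 / (2 * (𝒮.card : ℝ))) :
    MDM.limit loss p = sInf (MDM.feasibleValues loss p ε) ∧
      ((∀ S : 𝒮, ContinuousOn (loss S (p S)) (stdSimplex ℝ S.1)) →
        IsLeast (MDM.feasibleValues loss p ε) (MDM.limit loss p)) := by
  have hne : ∀ S : 𝒮, S.1.Nonempty := by
    intro S
    by_contra h
    have := Finset.not_nonempty_iff_eq_empty.1 h
    have hempty : IsEmpty S.1 := by rw [this]; infer_instance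
    have hsum := (hp S).2
    rw [Finset.univ_eq_empty, Finset.sum_empty] at hsum
    exact zero_ne_one hsum
  have hcard : (1 : ℝ) ≤ 𝒮.card := by
    rcases Nat.eq_zero_or_pos 𝒮.card with h | h
    -- For empty `𝒮` the bound `1 / (2 * 0)` is 0 by convention, contradicting `0 < ε`.
    · rw [h] at hε'
      norm_num at hε'
      linarith
    · exact_mod_cast h
  have hle : ε ≤ 1 / (𝒮.card : ℝ) :=
    hε'.le.trans (one_div_le_one_div_of_le (by linarith) (by linarith))
  have hle1 : ε ≤ 1 := hle.trans ((div_le_one (by linarith)).2 hcard)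
  have heq := MDM.limit_eq_sInf_feasibleValues (loss := loss) (p := p) hne hconv hreg hε hle1 hle
  refine ⟨heq, fun hcont => ?_⟩
  obtain ⟨v, hv⟩ := MDM.exists_isLeast_feasibleValues (loss := loss) (p := p) hne hle hcont
  rwa [heq, hv.isGLB.sInf_eq]
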